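/- **Theorem 4.1.** Let $m>0$ and $0<a^2\le m^2$. Put $\lambda(r,\theta)=r^2+a^2\cos^2\theta$, $\triangle(r)=r^2-2mr+a^2$ and $r_+=m+\sqrt{m^2-a^2}$. Let $(r,\theta,\varphi)$ be spherical coordinates on $\mathbb{R}^3$. Let $$M^a=\mathbb{R}\times\{x\in\mathbb{R}^3: r>m+\sqrt{m^2-a^2\cos^2\theta}\}$$ be the stationary Kerr spacetime, that is, the part of the outer region $r>r_+$ where $\beta(r,\theta)=1-\frac{2mr}{\lambda(r,\theta)}$ is positive. It carries the Kerr metric, which in Boyer-Lindquist coordinates $(t,r,\theta,\varphi)$ is $$ds^2=-\beta\,dt^2+\frac{\lambda}{\triangle}\,dr^2+\lambda\,d\theta^2+\Big[r^2+a^2+\frac{2mra^2\sin^2\theta}{\lambda}\Big]\sin^2\theta\,d\varphi^2-\frac{4mra\sin^2\theta}{\lambda}\,dt\,d\varphi$$ and which extends smoothly to the symmetry axis $\sin\theta=0$. Then $M^a$ is not geodesically connected: there are two points of $M^a$ that no geodesic of $M^a$ (of any causal character) joins. More precisely, for all $r_0,r_1$ with $r_+<r_0<r_1<2m$, the points of the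 symmetry axis with $(t,r,\theta)=(0,r_0,0)$ and $(t,r,\theta)=(0,r_1,\pi)$ belong to $M^a$ and cannot be joined by a geodesic lying in $M^a$. -/

import Mathlib

noncomputable section

/-! Geodesics of a metric given in one global chart `ℝ⁴`. -/

namespace SemiRiem

/-- Partial derivative `∂ f / ∂ x^l`. -/
def partialDeriv (l : Fin 4) (f : (Fin 4 → ℝ) → ℝ) (x : Fin 4 → ℝ) : ℝ :=
  fderiv ℝ f x (Pi.single l 1)

/-- Christoffel symbols `Γ^k_{ij}` of the Levi-Civita connection of the metric `g`:
`Γ^k_{ij} = ½ ∑_l g^{kl} (∂_i g_{jl} + ∂_j g_{il} - ∂_l g_{ij})`. -/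
def christoffel (g : (Fin 4 → ℝ) → Matrix (Fin 4) (Fin 4) ℝ) (k i j : Fin 4)
    (x : Fin 4 → ℝ) : ℝ :=
  (1 / 2) * ∑ l, (g x)⁻¹ k l *
    (partialDeriv i (fun y => g y j l) x + partialDeriv j (fun y => g y i l) x
      - partialDeriv l (fun y => g y i j) x)

/-- `γ`, restricted to the interval `I`, is a geodesic of `g`: it is twice differentiable
(one-sidedly at the endpoints) with velocity `v`, and
`(γ^k)'' + ∑_{i,j} Γ^k_{ij}(γ) (γ^i)' (γ^j)' = 0`. -/
def IsGeodesicOn (g : (Fin 4 → ℝ) → Matrix (Fin 4) (Fin 4) ℝ) (γ : ℝ → Fin 4 → ℝ)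
    (I : Set ℝ) : Prop :=
  ∃ v : ℝ → Fin 4 → ℝ,
    (∀ s ∈ I, HasDerivWithinAt γ (v s) I s) ∧
    (∀ s ∈ I, HasDerivWithinAt v
      (fun k => -∑ i, ∑ j, christoffel g k i j (γ s) * v s i * v s j) I s)

/-- `p` and `q` can be joined by a geodesic (of any causal character) of `g` that stays in the
region `M`. -/
def JoinedByGeodesic (g : (Fin 4 → ℝ) → Matrix (Fin 4) (Fin 4) ℝ) (M : Set (Fin 4 → ℝ))
    (p q : Fin 4 → ℝ) : Prop :=
  ∃ γ : ℝ → Fin 4 → ℝ, γ 0 = p ∧ γ 1 = q ∧ (∀ s ∈ Set.Icc (0 : ℝ) 1, γ s ∈ M) ∧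
    IsGeodesicOn g γ (Set.Icc 0 1)

/-- The region `M` with the metric `g` is geodesically connected: any two of its points can be
joined by a geodesic lying in `M`. -/
def GeodesicallyConnected (g : (Fin 4 → ℝ) → Matrix (Fin 4) (Fin 4) ℝ)
    (M : Set (Fin 4 → ℝ)) : Prop :=
  ∀ p ∈ M, ∀ q ∈ M, JoinedByGeodesic g M p q

end SemiRiem

/-! Kerr spacetime. Points of `ℝ × ℝ³` are vectors `x = (t, x₁, x₂, x₃)`, and the Boyer-Lindquist
coordinates `(t, r, θ, φ)` are spherical coordinates on the factor `ℝ³`. -/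

namespace Kerr

/-- The point with Boyer-Lindquist coordinates `b = (t, r, θ, φ)`. -/
def ofBL (b : Fin 4 → ℝ) : Fin 4 → ℝ :=
  ![b 0, b 1 * Real.sin (b 2) * Real.cos (b 3), b 1 * Real.sin (b 2) * Real.sin (b 3),
    b 1 * Real.cos (b 2)]

/-- `λ(r, θ) = r² + a² cos² θ`, with the argument `c = cos θ`. -/
def lam (a r c : ℝ) : ℝ := r ^ 2 + a ^ 2 * c ^ 2

/-- `Δ(r) = r² - 2 m r + a²`. -/
def Del (m a r : ℝ) : ℝ := r ^ 2 - 2 * m * r + a ^ 2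

/-- `β(r, θ) = 1 - 2 m r / λ(r, θ)`, with the argument `c = cos θ`. -/
def beta (m a r c : ℝ) : ℝ := 1 - 2 * m * r / lam a r c

/-- The radius `r₊ = m + √(m² - a²)` of the outer event horizon. -/
def rPlus (m a : ℝ) : ℝ := m + √(m ^ 2 - a ^ 2)

/-- The Kerr metric in Boyer-Lindquist coordinates `(t, r, θ, φ)`, in this order. -/
def blMetric (m a : ℝ) (b : Fin 4 → ℝ) : Matrix (Fin 4) (Fin 4) ℝ :=
  let r := b 1
  let s := Real.sin (b 2)
  let L := lam a r (Real.cos (b 2))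
  !![-1 + 2 * m * r / L, 0, 0, -(2 * m * r * a * s ^ 2 / L);
     0, L / Del m a r, 0, 0;
     0, 0, L, 0;
     -(2 * m * r * a * s ^ 2 / L), 0, 0, (r ^ 2 + a ^ 2 + 2 * m * r * a ^ 2 * s ^ 2 / L) * s ^ 2]

/-- The function `r` on `ℝ × ℝ³`. -/
def rad (x : Fin 4 → ℝ) : ℝ := √(x 1 ^ 2 + x 2 ^ 2 + x 3 ^ 2)

/-- The function `cos θ` on `ℝ × ℝ³`. -/
def cosTh (x : Fin 4 → ℝ) : ℝ := x 3 / rad x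

/-- The components of the one-form `dt`. -/
def dt : Fin 4 → ℝ := ![1, 0, 0, 0]

/-- The components of the one-form `dr`. -/
def dr (x : Fin 4 → ℝ) : Fin 4 → ℝ := ![0, x 1 / rad x, x 2 / rad x, x 3 / rad x]

/-- The components of the one-form `sin² θ dφ = (x₁ dx₂ - x₂ dx₁) / r²`, which is smooth also
on the axis. -/
def sinSqDphi (x : Fin 4 → ℝ) : Fin 4 → ℝ := ![0, -x 2 / rad x ^ 2, x 1 / rad x ^ 2, 0]

/-- The components of the round metric `dθ² + sin² θ dφ² = (dx₁² + dx₂² + dx₃² - dr²) / r²`. -/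
def sphereMetric (x : Fin 4 → ℝ) (i j : Fin 4) : ℝ :=
  ((if i = j then 1 else 0) - dt i * dt j - dr x i * dr x j) / rad x ^ 2

/-- The Kerr metric on `ℝ × ℝ³` (where `r > r₊`), including the symmetry axis. Since
`λ dθ² + (r² + a²) sin² θ dφ² = λ (dθ² + sin² θ dφ²) + a² (sin² θ dφ)²`, the expression
below is the Boyer-Lindquist form of the metric off the axis (`jacobian_kerrMetric` proves it) and its
smooth extension to the axis. -/
def kerrMetric (m a : ℝ) (x : Fin 4 → ℝ) : Matrix (Fin 4) (Fin 4) ℝ :=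
  Matrix.of fun i j =>
    (-beta m a (rad x) (cosTh x)) * (dt i * dt j)
    + lam a (rad x) (cosTh x) / Del m a (rad x) * (dr x i * dr x j)
    + lam a (rad x) (cosTh x) * sphereMetric x i j
    + a ^ 2 * (1 + 2 * m * rad x / lam a (rad x) (cosTh x)) * (sinSqDphi x i * sinSqDphi x j)
    - 2 * m * rad x * a / lam a (rad x) (cosTh x)
        * (dt i * sinSqDphi x j + sinSqDphi x i * dt j)

/-- The stationary Kerr spacetime `M^a`, the region `r > m + √(m² - a² cos² θ)` of `ℝ × ℝ³`. -/
def stationaryKerr (m a : ℝ) : Set (Fin 4 → ℝ) :=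
  {x | m + √(m ^ 2 - a ^ 2 * cosTh x ^ 2) < rad x}

/-! Checks that these definitions are the intended ones. -/

/-- The Jacobian matrix of `ofBL`. -/
def jacobian (b : Fin 4 → ℝ) : Matrix (Fin 4) (Fin 4) ℝ :=
  let r := b 1
  let s := Real.sin (b 2)
  let c := Real.cos (b 2)
  let sp := Real.sin (b 3)
  let cp := Real.cos (b 3)
  !![1, 0, 0, 0;
     0, s * cp, r * c * cp, -(r * s * sp);
     0, s * sp, r * c * sp, r * s * cp;
     0, c, -(r * s), 0]

theorem hasFDerivAt_ofBL (b : Fin 4 → ℝ) :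
    HasFDerivAt ofBL (Matrix.toLin' (jacobian b)).toContinuousLinearMap b := by
  have h : ∀ i : Fin 4, HasFDerivAt (fun y : Fin 4 → ℝ => y i)
      (ContinuousLinearMap.proj (R := ℝ) (φ := fun _ : Fin 4 => ℝ) i) b :=
    fun i => hasFDerivAt_apply i b
  rw [hasFDerivAt_pi']
  intro i
  fin_cases i
  · refine (h 0).congr_fderiv ?_
    ext w
    simp [jacobian, dotProduct, Fin.sum_univ_four]
  · refine (((h 1).mul (h 2).sin).mul (h 3).cos).congr_fderiv ?_
    ext w
    simp [jacobian, dotProduct, Fin.sum_univ_four]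
    ring
  · refine (((h 1).mul (h 2).sin).mul (h 3).sin).congr_fderiv ?_
    ext w
    simp [jacobian, dotProduct, Fin.sum_univ_four]
    ring
  · refine ((h 1).mul (h 2).cos).congr_fderiv ?_
    ext w
    simp [jacobian, dotProduct, Fin.sum_univ_four]
    ring

theorem rad_ofBL (b : Fin 4 → ℝ) (hr : 0 ≤ b 1) : rad (ofBL b) = b 1 := by
  have h1 := Real.sin_sq_add_cos_sq (b 2)
  have h2 := Real.sin_sq_add_cos_sq (b 3)
  rw [rad, Real.sqrt_eq_iff_mul_self_eq (by positivity) hr]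
  simp only [ofBL, Matrix.cons_val]
  linear_combination (b 1) ^ 2 * h1 + (b 1) ^ 2 * Real.sin (b 2) ^ 2 * h2

theorem cosTh_ofBL (b : Fin 4 → ℝ) (hr : 0 < b 1) : cosTh (ofBL b) = Real.cos (b 2) := by
  rw [cosTh, rad_ofBL b hr.le]
  simp only [ofBL, Matrix.cons_val]
  field_simp

theorem kerrMetric_apply (m a : ℝ) (x u v : Fin 4 → ℝ) :
    u ⬝ᵥ (kerrMetric m a x).mulVec v =
      (-beta m a (rad x) (cosTh x)) * ((dt ⬝ᵥ u) * (dt ⬝ᵥ v))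
      + lam a (rad x) (cosTh x) / Del m a (rad x) * ((dr x ⬝ᵥ u) * (dr x ⬝ᵥ v))
      + lam a (rad x) (cosTh x) *
          ((u ⬝ᵥ v - (dt ⬝ᵥ u) * (dt ⬝ᵥ v) - (dr x ⬝ᵥ u) * (dr x ⬝ᵥ v)) / rad x ^ 2)
      + a ^ 2 * (1 + 2 * m * rad x / lam a (rad x) (cosTh x))
          * ((sinSqDphi x ⬝ᵥ u) * (sinSqDphi x ⬝ᵥ v))
      - 2 * m * rad x * a / lam a (rad x) (cosTh x)
          * ((dt ⬝ᵥ u) * (sinSqDphi x ⬝ᵥ v) + (sinSqDphi x ⬝ᵥ u) * (dt ⬝ᵥ v)) := by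
  generalize hL : lam a (rad x) (cosTh x) = L
  generalize hB : beta m a (rad x) (cosTh x) = B
  simp only [kerrMetric, sphereMetric, hL, hB, Matrix.mulVec, dotProduct, Fin.sum_univ_four,
    Matrix.of_apply, dt, Matrix.cons_val, Fin.isValue]
  simp
  ring

/-- The pullback of `kerrMetric` to Boyer-Lindquist coordinates is `blMetric`. -/
theorem jacobian_kerrMetric (m a : ℝ) (b : Fin 4 → ℝ) (hr : 0 < b 1) :
    (jacobian b).transpose * kerrMetric m a (ofBL b) * jacobian b = blMetric m a b := by
  have h1 := Real.sin_sq_add_cos_sq (b 2)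
  have h2 := Real.sin_sq_add_cos_sq (b 3)
  have hL : 0 < lam a (b 1) (Real.cos (b 2)) := by unfold lam; positivity
  have hL' : lam a (b 1) (Real.cos (b 2)) = b 1 ^ 2 + a ^ 2 * Real.cos (b 2) ^ 2 := rfl
  have hR := rad_ofBL b hr.le
  have hC := cosTh_ofBL b hr
  have ht : ∀ j, dt ⬝ᵥ (jacobian b).col j = ![1, 0, 0, 0] j := by
    intro j
    fin_cases j <;> simp [dt, jacobian, dotProduct, Fin.sum_univ_four]
  have hdr : dr (ofBL b) = ![0, Real.sin (b 2) * Real.cos (b 3),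
      Real.sin (b 2) * Real.sin (b 3), Real.cos (b 2)] := by
    rw [dr, hR]
    ext j
    fin_cases j <;> simp [ofBL] <;> field_simp
  have hdw : sinSqDphi (ofBL b) = ![0, -(Real.sin (b 2) * Real.sin (b 3)) / b 1,
      Real.sin (b 2) * Real.cos (b 3) / b 1, 0] := by
    rw [sinSqDphi, hR]
    ext j
    fin_cases j <;> simp [ofBL] <;> field_simp
  have hd : ∀ j, dr (ofBL b) ⬝ᵥ (jacobian b).col j = ![0, 1, 0, 0] j := by
    intro j
    fin_cases j <;> simp [hdr, jacobian, dotProduct, Fin.sum_univ_four] <;>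
      grind
  have hw : ∀ j, sinSqDphi (ofBL b) ⬝ᵥ (jacobian b).col j = ![0, 0, 0, Real.sin (b 2) ^ 2] j := by
    intro j
    fin_cases j <;> simp [hdw, jacobian, dotProduct, Fin.sum_univ_four] <;>
      field_simp <;> grind
  have hJ : ∀ i j, (jacobian b).col i ⬝ᵥ (jacobian b).col j =
      Matrix.diagonal ![1, 1, b 1 ^ 2, b 1 ^ 2 * Real.sin (b 2) ^ 2] i j := by
    intro i j
    fin_cases i <;> fin_cases j <;>
      simp [jacobian, dotProduct, Fin.sum_univ_four, Matrix.diagonal] <;> grind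
  have key : ∀ i j, ((jacobian b).transpose * kerrMetric m a (ofBL b) * jacobian b) i j =
      (jacobian b).col i ⬝ᵥ (kerrMetric m a (ofBL b)).mulVec ((jacobian b).col j) := by
    intro i j
    rw [Matrix.mul_assoc]
    rfl
  ext i j
  rw [key, kerrMetric_apply, ht, ht, hd, hd, hw, hw, hJ, hR, hC]
  unfold blMetric beta
  generalize lam a (b 1) (Real.cos (b 2)) = L at *
  generalize Real.cos (b 2) = c at *
  generalize Real.sin (b 2) = s at *
  fin_cases i <;> fin_cases j <;> simp [Matrix.diagonal] <;> field_simp <;> grind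

/-- The metric is nondegenerate where `r > 0` and `Δ ≠ 0`, in particular for `r > r₊`. -/
theorem det_kerrMetric (m a : ℝ) (x : Fin 4 → ℝ) (hr : 0 < rad x) (hD : Del m a (rad x) ≠ 0) :
    (kerrMetric m a x).det = -(lam a (rad x) (cosTh x) ^ 2 / rad x ^ 4) := by
  have hL : 0 < lam a (rad x) (cosTh x) := by unfold lam; positivity
  have hN : (x 1 / rad x) ^ 2 + (x 2 / rad x) ^ 2 + cosTh x ^ 2 = 1 := by
    have : rad x ^ 2 = x 1 ^ 2 + x 2 ^ 2 + x 3 ^ 2 := Real.sq_sqrt (by positivity)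
    unfold cosTh
    field_simp
    linarith
  have gen : ∀ B A k C D n p c q : ℝ, n ^ 2 + p ^ 2 + c ^ 2 = 1 →
      Matrix.det !![-B, D * (p * q), -(D * (n * q)), 0;
        D * (p * q), A * n ^ 2 + k * (1 - n ^ 2) + C * (p * q) ^ 2,
          (A - k) * (n * p) - C * (p * q) * (n * q), (A - k) * (n * c);
        -(D * (n * q)), (A - k) * (n * p) - C * (p * q) * (n * q),
          A * p ^ 2 + k * (1 - p ^ 2) + C * (n * q) ^ 2, (A - k) * (p * c);
        0, (A - k) * (n * c), (A - k) * (p * c), A * c ^ 2 + k * (1 - c ^ 2)] =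
      A * k * (-B * (k + C * ((1 - c ^ 2) * q ^ 2)) - D ^ 2 * ((1 - c ^ 2) * q ^ 2)) := by
    intro B A k C D n p c q h
    have h' : 1 - c ^ 2 = n ^ 2 + p ^ 2 := by linarith
    rw [Matrix.det_succ_row_zero]
    trans A * k * (-B * (k + C * ((n ^ 2 + p ^ 2) * q ^ 2)) - D ^ 2 * ((n ^ 2 + p ^ 2) * q ^ 2))
    swap
    · rw [h']
    simp [Fin.sum_univ_succ, Matrix.det_fin_three, Fin.succAbove, Matrix.submatrix]
    linear_combination (k * (A - k) * (-B * (k + C * ((n ^ 2 + p ^ 2) * q ^ 2))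
      - D ^ 2 * ((n ^ 2 + p ^ 2) * q ^ 2))) * h
  obtain ⟨B, hB⟩ : ∃ B, B = beta m a (rad x) (cosTh x) := ⟨_, rfl⟩
  obtain ⟨A, hA⟩ : ∃ A, A = lam a (rad x) (cosTh x) / Del m a (rad x) := ⟨_, rfl⟩
  obtain ⟨k, hk⟩ : ∃ k, k = lam a (rad x) (cosTh x) / rad x ^ 2 := ⟨_, rfl⟩
  obtain ⟨C, hC⟩ : ∃ C, C = a ^ 2 * (1 + 2 * m * rad x / lam a (rad x) (cosTh x)) := ⟨_, rfl⟩
  obtain ⟨D, hDD⟩ : ∃ D, D = 2 * m * rad x * a / lam a (rad x) (cosTh x) := ⟨_, rfl⟩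
  have hG : kerrMetric m a x =
      (fun n p c q : ℝ => !![-B, D * (p * q), -(D * (n * q)), 0;
        D * (p * q), A * n ^ 2 + k * (1 - n ^ 2) + C * (p * q) ^ 2,
          (A - k) * (n * p) - C * (p * q) * (n * q), (A - k) * (n * c);
        -(D * (n * q)), (A - k) * (n * p) - C * (p * q) * (n * q),
          A * p ^ 2 + k * (1 - p ^ 2) + C * (n * q) ^ 2, (A - k) * (p * c);
        0, (A - k) * (n * c), (A - k) * (p * c), A * c ^ 2 + k * (1 - c ^ 2)])
      (x 1 / rad x) (x 2 / rad x) (cosTh x) (1 / rad x) := by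
    subst hB hA hk hC hDD
    ext i j
    unfold kerrMetric sphereMetric
    generalize lam a (rad x) (cosTh x) = L
    generalize beta m a (rad x) (cosTh x) = B
    generalize Del m a (rad x) = D
    unfold cosTh
    fin_cases i <;> fin_cases j <;> simp [dt, dr, sinSqDphi] <;> ring_nf <;> simp
  rw [hG]
  beta_reduce
  rw [gen _ _ _ _ _ _ _ _ _ hN]
  subst hB hA hk hC hDD
  unfold beta
  have hD' : Del m a (rad x) = rad x ^ 2 - 2 * m * rad x + a ^ 2 := rfl
  have hL' : lam a (rad x) (cosTh x) = rad x ^ 2 + a ^ 2 * cosTh x ^ 2 := rfl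
  generalize Del m a (rad x) = D at *
  generalize lam a (rad x) (cosTh x) = L at *
  generalize cosTh x = c at *
  generalize rad x = r at *
  field_simp
  grind

/-- `M^a` is the part of the outer region `r > r₊` where `β > 0`. -/
theorem mem_stationaryKerr_iff (m a : ℝ) (hm : 0 < m) (x : Fin 4 → ℝ) :
    x ∈ stationaryKerr m a ↔
      rPlus m a < rad x ∧ 0 < beta m a (rad x) (cosTh x) := by
  have hr0 : 0 ≤ rad x := Real.sqrt_nonneg _
  have hc : cosTh x ^ 2 ≤ 1 := by
    have : rad x ^ 2 = x 1 ^ 2 + x 2 ^ 2 + x 3 ^ 2 := Real.sq_sqrt (by positivity)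
    rw [cosTh, div_pow, this]
    exact div_le_one_of_le₀ (by nlinarith [sq_nonneg (x 1), sq_nonneg (x 2)]) (by positivity)
  have hac : a ^ 2 * cosTh x ^ 2 ≤ a ^ 2 := mul_le_of_le_one_right (sq_nonneg a) hc
  have hs : √(m ^ 2 - a ^ 2) ≤ √(m ^ 2 - a ^ 2 * cosTh x ^ 2) := Real.sqrt_le_sqrt (by linarith)
  have hp : 0 ≤ √(m ^ 2 - a ^ 2) := Real.sqrt_nonneg _
  have hb : m < rad x → (0 < beta m a (rad x) (cosTh x) ↔
      m ^ 2 - a ^ 2 * cosTh x ^ 2 < (rad x - m) ^ 2) := by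
    intro h
    have hr : 0 < rad x := hm.trans h
    have hL : 0 < lam a (rad x) (cosTh x) := by unfold lam; positivity
    rw [beta, sub_pos, div_lt_one hL, lam]
    constructor <;> intro h <;> nlinarith
  unfold stationaryKerr rPlus
  rw [Set.mem_ofPred_eq]
  constructor
  · intro h
    refine ⟨by linarith, (hb (by linarith)).2 ?_⟩
    exact (Real.sqrt_lt' (by linarith)).1 (by linarith)
  · rintro ⟨h1, h2⟩
    have := (Real.sqrt_lt' (by linarith)).2 ((hb (by linarith)).1 h2)
    linarith

end Kerr

end

/-!
Why two points of the axis, below the height `2 m` and on opposite sides of the equatorial plane,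
are not joined by a geodesic.

Let `p = g(γ', ·)` be the momentum of a geodesic `γ` from one point to the other. For a vector
field `Y` along `γ`, the geodesic equation reads
`d/ds p(Y) = g(γ', Y') + ½ (∂_Y g)(γ', γ')` (`SemiRiem.hasDerivWithinAt_momentum`). This yields
everything that is needed, without computing any Christoffel symbol.

* The angular momentum `p(∂_φ)` is conserved, and it vanishes because `∂_φ = 0` on the axis.
* The energy `p(∂_t)` is conserved. When the angular momentum is zero it equals `-q t'` with a
  factor `q > 0`, because `β > 0` (`exists_energy_eq_neg_mul`). As `t` takes the same value at both
  ends, `t'` vanishes somewhere, so the energy is zero, so `t' = 0` everywhere, and then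
  `sin² θ φ' = 0` too.
* Such a geodesic moves in a meridian plane with the Riemannian metric
  `λ (dr² / Δ + dθ²)`. Taking for `Y` the dilation field `r ∂_r` one finds
  `(λ r')' = λ (r - m) r'² / Δ + r r'² + r Δ θ'² ≥ 0`
  (`exists_hasDerivWithinAt_lam_mul_dr`). Hence `λ r'` is nondecreasing, and `r` is at most the
  larger of its two boundary values (`rad_le_max_of_isGeodesicOn`), which is below `2 m`.

But `γ` has to cross the equatorial plane `θ = π / 2`, where the stationary region lies in
`r > 2 m`.

All vector fields used are written in Cartesian coordinates, where they are smooth also on the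
axis.
-/

noncomputable section

/-! ### Momentum along a geodesic -/

namespace SemiRiem

open Matrix

theorem fderiv_eq_sum_partialDeriv (f : (Fin 4 → ℝ) → ℝ) (x w : Fin 4 → ℝ) :
    fderiv ℝ f x w = ∑ i, w i * partialDeriv i f x := by
  have h := LinearMap.pi_apply_eq_sum_univ (fderiv ℝ f x).toLinearMap w
  simp only [ContinuousLinearMap.coe_coe, smul_eq_mul] at h
  rw [h]
  refine Finset.sum_congr rfl fun i _ => ?_
  rw [partialDeriv]
  congr 3
  ext j
  simp [Pi.single_apply, eq_comm]

/-- The geodesic equation with its index lowered. -/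
theorem mulVec_acceleration {g : (Fin 4 → ℝ) → Matrix (Fin 4) (Fin 4) ℝ} {x : Fin 4 → ℝ}
    (hdet : (g x).det ≠ 0) (u : Fin 4 → ℝ) (l : Fin 4) :
    (g x *ᵥ fun k => -∑ i, ∑ j, christoffel g k i j x * u i * u j) l =
      -((1 / 2) * ∑ i, ∑ j, (partialDeriv i (fun y => g y j l) x
        + partialDeriv j (fun y => g y i l) x - partialDeriv l (fun y => g y i j) x)
          * u i * u j) := by
  -- The acceleration is `g⁻¹ B`, so that `g` cancels `g⁻¹`.
  set B : Fin 4 → ℝ := fun l => -((1 / 2) * ∑ i, ∑ j, (partialDeriv i (fun y => g y j l) x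
        + partialDeriv j (fun y => g y i l) x - partialDeriv l (fun y => g y i j) x)
          * u i * u j) with hB
  have hv : (fun k => -∑ i, ∑ j, christoffel g k i j x * u i * u j) = (g x)⁻¹ *ᵥ B := by
    ext k
    simp only [hB, christoffel, mulVec, dotProduct, mul_neg, Finset.sum_neg_distrib,
      Finset.mul_sum, Finset.sum_mul]
    congr 1
    rw [Finset.sum_comm]
    conv_lhs => enter [2, j]; rw [Finset.sum_comm]
    rw [Finset.sum_comm]
    refine Finset.sum_congr rfl fun l _ => ?_
    rw [Finset.sum_comm]
    refine Finset.sum_congr rfl fun i _ => Finset.sum_congr rfl fun j _ => ?_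
    ring
  rw [hv, mulVec_mulVec, mul_nonsing_inv _ (isUnit_iff_ne_zero.2 hdet), one_mulVec]

/-- Along a geodesic `γ` with velocity `v`,
`d/ds g(Y, v) = g(Y', v) + ½ (∂_Y g)(v, v)` for every vector field `Y` along `γ`. -/
theorem hasDerivWithinAt_momentum {g : (Fin 4 → ℝ) → Matrix (Fin 4) (Fin 4) ℝ}
    {γ v Y : ℝ → Fin 4 → ℝ} {Y' : Fin 4 → ℝ} {I : Set ℝ} {s : ℝ}
    (hsymm : ∀ y, (g y).IsSymm) (hdet : (g (γ s)).det ≠ 0)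
    (hg : ∀ i j, DifferentiableAt ℝ (fun y => g y i j) (γ s))
    (hγ : HasDerivWithinAt γ (v s) I s)
    (hv : HasDerivWithinAt v
      (fun k => -∑ i, ∑ j, christoffel g k i j (γ s) * v s i * v s j) I s)
    (hY : HasDerivWithinAt Y Y' I s) :
    HasDerivWithinAt (fun s => Y s ⬝ᵥ g (γ s) *ᵥ v s)
      (Y' ⬝ᵥ g (γ s) *ᵥ v s
        + 1 / 2 * fderiv ℝ (fun y => v s ⬝ᵥ g y *ᵥ v s) (γ s) (Y s)) I s := by
  set A : Fin 4 → ℝ := fun k => -∑ i, ∑ j, christoffel g k i j (γ s) * v s i * v s j with hA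
  have hacc := mulVec_acceleration hdet (v s)
  rw [← hA] at hacc
  have hD : ∀ i j l, partialDeriv i (fun y => g y j l) (γ s)
      = partialDeriv i (fun y => g y l j) (γ s) := by
    intro i j l
    congr 1
    ext y
    exact (hsymm y).apply l j
  have hq : fderiv ℝ (fun y => v s ⬝ᵥ g y *ᵥ v s) (γ s) (Y s) =
      ∑ l, Y s l * ∑ i, ∑ j, partialDeriv l (fun y => g y i j) (γ s) * v s i * v s j := by
    rw [fderiv_eq_sum_partialDeriv]
    refine Finset.sum_congr rfl fun l _ => ?_
    congr 1
    have hq' : HasFDerivAt (fun y => v s ⬝ᵥ g y *ᵥ v s)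
        (∑ i, v s i • ∑ j, v s j • fderiv ℝ (fun y => g y i j) (γ s)) (γ s) := by
      simp only [dotProduct, mulVec]
      exact HasFDerivAt.fun_sum fun i _ => (HasFDerivAt.fun_sum fun j _ =>
        (hg i j).hasFDerivAt.mul_const (v s j)).const_mul (v s i)
    rw [partialDeriv, hq'.fderiv]
    simp only [_root_.sum_apply, _root_.smul_apply, smul_eq_mul,
      Finset.mul_sum, partialDeriv]
    refine Finset.sum_congr rfl fun i _ => Finset.sum_congr rfl fun j _ => ?_
    ring
  have hγ' : ∀ i j, HasDerivWithinAt (fun s => g (γ s) i j)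
      (∑ l, v s l * partialDeriv l (fun y => g y i j) (γ s)) I s := by
    intro i j
    have h := (hg i j).hasFDerivAt.comp_hasDerivWithinAt s hγ
    rwa [fderiv_eq_sum_partialDeriv] at h
  have hmain : HasDerivWithinAt (fun s => Y s ⬝ᵥ g (γ s) *ᵥ v s)
      (∑ l, (Y' l * ∑ k, g (γ s) l k * v s k + Y s l * ∑ k,
        ((∑ i, v s i * partialDeriv i (fun y => g y l k) (γ s)) * v s k
          + g (γ s) l k * A k))) I s := by
    simp only [dotProduct, mulVec]
    exact HasDerivWithinAt.fun_sum fun l _ => ((hasDerivWithinAt_pi.1 hY) l).mul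
      (HasDerivWithinAt.fun_sum fun k _ => (hγ' l k).mul ((hasDerivWithinAt_pi.1 hv) k))
  refine hmain.congr_deriv ?_
  rw [hq, Finset.sum_add_distrib, Finset.mul_sum]
  congr 1
  refine Finset.sum_congr rfl fun l _ => ?_
  rw [Finset.sum_add_distrib]
  have h1 : ∑ k, g (γ s) l k * A k = (g (γ s) *ᵥ A) l := rfl
  have h2 : ∑ k, (∑ i, v s i * partialDeriv i (fun y => g y l k) (γ s)) * v s k
      = ∑ i, ∑ j, partialDeriv i (fun y => g y j l) (γ s) * v s i * v s j := by
    simp only [Finset.sum_mul]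
    rw [Finset.sum_comm]
    refine Finset.sum_congr rfl fun i _ => Finset.sum_congr rfl fun j _ => ?_
    rw [hD i l j]
    ring
  -- The first two terms of the Christoffel symbol agree when contracted with `v^i v^j`.
  have h3 : ∑ i, ∑ j, partialDeriv j (fun y => g y i l) (γ s) * v s i * v s j
      = ∑ i, ∑ j, partialDeriv i (fun y => g y j l) (γ s) * v s i * v s j := by
    rw [Finset.sum_comm]
    refine Finset.sum_congr rfl fun i _ => Finset.sum_congr rfl fun j _ => ?_
    ring
  rw [h1, hacc, h2]
  simp only [sub_mul, add_mul, Finset.sum_add_distrib, Finset.sum_sub_distrib]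
  rw [h3]
  ring

end SemiRiem

namespace Kerr

open Matrix Set

/-! ### Regularity of the Kerr metric -/

theorem isSymm_kerrMetric (m a : ℝ) (x : Fin 4 → ℝ) : (kerrMetric m a x).IsSymm := by
  ext i j
  simp only [kerrMetric, sphereMetric, transpose_apply, of_apply, eq_comm (a := i) (b := j)]
  ring

theorem sq_rad (x : Fin 4 → ℝ) : rad x ^ 2 = x 1 ^ 2 + x 2 ^ 2 + x 3 ^ 2 :=
  Real.sq_sqrt (by positivity)

theorem lam_pos {r : ℝ} (hr : 0 < r) (a c : ℝ) : 0 < lam a r c := by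
  unfold lam; positivity

theorem differentiableAt_rad {x : Fin 4 → ℝ} (hx : 0 < rad x) : DifferentiableAt ℝ rad x := by
  have : x 1 ^ 2 + x 2 ^ 2 + x 3 ^ 2 ≠ 0 := (Real.sqrt_pos.1 hx).ne'
  unfold rad
  exact DifferentiableAt.sqrt (by fun_prop) this

theorem differentiableAt_kerrMetric {m a : ℝ} {x : Fin 4 → ℝ} (hx : 0 < rad x)
    (hD : Del m a (rad x) ≠ 0) (i j : Fin 4) :
    DifferentiableAt ℝ (fun y => kerrMetric m a y i j) x := by
  have hr := differentiableAt_rad hx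
  have hr0 := hx.ne'
  have h2 : rad x ^ 2 ≠ 0 := by positivity
  have hc : DifferentiableAt ℝ cosTh x := by
    unfold cosTh
    fun_prop (disch := assumption)
  have hL : DifferentiableAt ℝ (fun y => lam a (rad y) (cosTh y)) x := by
    unfold lam; fun_prop
  have hL0 : lam a (rad x) (cosTh x) ≠ 0 := (lam_pos hx _ _).ne'
  have hΔ : DifferentiableAt ℝ (fun y => Del m a (rad y)) x := by
    unfold Del; fun_prop
  have hdr : ∀ i, DifferentiableAt ℝ (fun y => dr y i) x := by
    intro i
    have h : ∀ k : Fin 4, DifferentiableAt ℝ (fun y : Fin 4 → ℝ => y k / rad y) x := by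
      intro k
      fun_prop (disch := assumption)
    fin_cases i
    · exact differentiableAt_const _
    · exact h 1
    · exact h 2
    · exact h 3
  have hdw : ∀ i, DifferentiableAt ℝ (fun y => sinSqDphi y i) x := by
    intro i
    fin_cases i
    · exact differentiableAt_const _
    · change DifferentiableAt ℝ (fun y : Fin 4 → ℝ => -y 2 / rad y ^ 2) x
      fun_prop (disch := assumption)
    · change DifferentiableAt ℝ (fun y : Fin 4 → ℝ => y 1 / rad y ^ 2) x
      fun_prop (disch := assumption)
    · exact differentiableAt_const _
  have hi := hdr i
  have hj := hdr j
  have hi' := hdw i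
  have hj' := hdw j
  simp only [kerrMetric, sphereMetric, of_apply, beta]
  fun_prop (disch := assumption)

/-! ### Symmetries of the Kerr metric -/

/-- The rotation by the angle `e` about the symmetry axis. -/
def axialRotation (e : ℝ) (x : Fin 4 → ℝ) : Fin 4 → ℝ :=
  ![x 0, Real.cos e * x 1 - Real.sin e * x 2, Real.sin e * x 1 + Real.cos e * x 2, x 3]

/-- The axial Killing field `∂_φ`, as a linear map of `ℝ⁴`. -/
def axial (x : Fin 4 → ℝ) : Fin 4 → ℝ := ![0, -x 2, x 1, 0]

/-- The spatial part of `x`, that is, the dilation field `r ∂_r`. -/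
def spatial (x : Fin 4 → ℝ) : Fin 4 → ℝ := ![0, x 1, x 2, x 3]

theorem rad_axialRotation (e : ℝ) (x : Fin 4 → ℝ) : rad (axialRotation e x) = rad x := by
  unfold rad
  congr 1
  simp only [axialRotation, Matrix.cons_val]
  linear_combination (x 1 ^ 2 + x 2 ^ 2) * Real.sin_sq_add_cos_sq e

/-- Rotations about the axis are isometries. The rotation is moved onto the vector, so that the
left side can be differentiated in the base point alone. -/
theorem kerrMetric_axialRotation (m a e : ℝ) (x u : Fin 4 → ℝ) :
    u ⬝ᵥ kerrMetric m a (axialRotation e x) *ᵥ u =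
      axialRotation (-e) u ⬝ᵥ kerrMetric m a x *ᵥ axialRotation (-e) u := by
  have hc : cosTh (axialRotation e x) = cosTh x := by
    rw [cosTh, rad_axialRotation]; rfl
  have ht : dt ⬝ᵥ axialRotation (-e) u = dt ⬝ᵥ u := by
    simp [dt, dotProduct, Fin.sum_univ_four, axialRotation]
  have hd : dr (axialRotation e x) ⬝ᵥ u = dr x ⬝ᵥ axialRotation (-e) u := by
    rw [dr, rad_axialRotation]
    simp [dr, dotProduct, Fin.sum_univ_four, axialRotation]
    ring
  have hw : sinSqDphi (axialRotation e x) ⬝ᵥ u = sinSqDphi x ⬝ᵥ axialRotation (-e) u := by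
    rw [sinSqDphi, rad_axialRotation]
    simp [sinSqDphi, dotProduct, Fin.sum_univ_four, axialRotation]
    ring
  have hn : axialRotation (-e) u ⬝ᵥ axialRotation (-e) u = u ⬝ᵥ u := by
    simp [dotProduct, Fin.sum_univ_four, axialRotation]
    linear_combination (u 1 ^ 2 + u 2 ^ 2) * Real.sin_sq_add_cos_sq e
  rw [kerrMetric_apply, kerrMetric_apply, rad_axialRotation, hc, ht, hd, hw, hn]

theorem hasDerivAt_axialRotation (x : Fin 4 → ℝ) :
    HasDerivAt (fun e => axialRotation e x) (axial x) 0 := by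
  rw [hasDerivAt_pi]
  have hs := Real.hasDerivAt_sin 0
  have hc := Real.hasDerivAt_cos 0
  rw [Real.cos_zero] at hs
  rw [Real.sin_zero] at hc
  intro i
  fin_cases i
  · exact hasDerivAt_const _ _
  · exact ((hc.mul_const (x 1)).sub (hs.mul_const (x 2))).congr_deriv (by simp [axial])
  · exact ((hs.mul_const (x 1)).add (hc.mul_const (x 2))).congr_deriv (by simp [axial])
  · exact hasDerivAt_const _ _

theorem differentiableAt_kerrMetric_quadratic {m a : ℝ} {x : Fin 4 → ℝ} (hx : 0 < rad x)
    (hD : Del m a (rad x) ≠ 0) (u : Fin 4 → ℝ) :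
    DifferentiableAt ℝ (fun y => u ⬝ᵥ kerrMetric m a y *ᵥ u) x := by
  have h := differentiableAt_kerrMetric (a := a) hx hD
  simp only [dotProduct, mulVec]
  fun_prop

/-- The Killing equation of `∂_φ`, contracted twice with `u`. -/
theorem fderiv_kerrMetric_axial {m a : ℝ} {x : Fin 4 → ℝ} (hx : 0 < rad x)
    (hD : Del m a (rad x) ≠ 0) (u : Fin 4 → ℝ) :
    fderiv ℝ (fun y => u ⬝ᵥ kerrMetric m a y *ᵥ u) x (axial x) =
      -(2 * (axial u ⬝ᵥ kerrMetric m a x *ᵥ u)) := by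
  have h0 : ∀ y, axialRotation 0 y = y := by
    intro y
    ext i
    fin_cases i <;> simp [axialRotation]
  have h1 : HasDerivAt (fun e => u ⬝ᵥ kerrMetric m a (axialRotation e x) *ᵥ u)
      (fderiv ℝ (fun y => u ⬝ᵥ kerrMetric m a y *ᵥ u) x (axial x)) 0 := by
    have h := (differentiableAt_kerrMetric_quadratic hx hD u).hasFDerivAt
    rw [← h0 x] at h
    have h2 := h.comp_hasDerivAt 0 (hasDerivAt_axialRotation x)
    rw [h0] at h2
    exact h2
  have hrot : HasDerivAt (fun e => axialRotation (-e) u) (-axial u) 0 := by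
    have h := hasDerivAt_axialRotation u
    rw [← neg_zero] at h
    exact (h.scomp 0 (hasDerivAt_neg 0)).congr_deriv (by simp)
  have h2 : HasDerivAt
      (fun e => axialRotation (-e) u ⬝ᵥ kerrMetric m a x *ᵥ axialRotation (-e) u)
      (-axial u ⬝ᵥ kerrMetric m a x *ᵥ u + u ⬝ᵥ kerrMetric m a x *ᵥ (-axial u)) 0 := by
    have hr := hasDerivAt_pi.1 hrot
    have h : HasDerivAt
        (fun e => axialRotation (-e) u ⬝ᵥ kerrMetric m a x *ᵥ axialRotation (-e) u)
        (∑ i, ((-axial u) i * ∑ j, kerrMetric m a x i j * axialRotation (-0) u j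
          + axialRotation (-0) u i * ∑ j, kerrMetric m a x i j * (-axial u) j)) 0 := by
      simp only [dotProduct, mulVec]
      exact HasDerivAt.fun_sum fun i _ => (hr i).mul
        (HasDerivAt.fun_sum fun j _ => (hr j).const_mul _)
    refine h.congr_deriv ?_
    rw [neg_zero, h0, Finset.sum_add_distrib]
    rfl
  -- `h1` and `h2` differentiate the two sides of `kerrMetric_axialRotation` at the angle zero.
  simp only [kerrMetric_axialRotation] at h1
  have hs : u ⬝ᵥ kerrMetric m a x *ᵥ axial u = axial u ⬝ᵥ kerrMetric m a x *ᵥ u := by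
    rw [dotProduct_mulVec, ← mulVec_transpose, (isSymm_kerrMetric m a x).eq, dotProduct_comm]
  rw [h1.unique h2, mulVec_neg, dotProduct_neg, neg_dotProduct, hs]
  ring

/-- The Killing equation of `∂_t`. -/
theorem fderiv_kerrMetric_time {m a : ℝ} {x : Fin 4 → ℝ} (hx : 0 < rad x)
    (hD : Del m a (rad x) ≠ 0) (u : Fin 4 → ℝ) :
    fderiv ℝ (fun y => u ⬝ᵥ kerrMetric m a y *ᵥ u) x dt = 0 := by
  have hl := (differentiableAt_kerrMetric_quadratic hx hD u).hasFDerivAt.hasLineDerivAt dt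
  have hc : HasLineDerivAt ℝ (fun y => u ⬝ᵥ kerrMetric m a y *ᵥ u) 0 x dt := by
    unfold HasLineDerivAt
    refine (hasDerivAt_const (0 : ℝ) (u ⬝ᵥ kerrMetric m a x *ᵥ u)).congr_of_eventuallyEq ?_
    refine Filter.Eventually.of_forall fun e => ?_
    have h : ∀ i, i ≠ 0 → (x + e • dt) i = x i := by
      intro i hi
      fin_cases i <;> simp_all [dt]
    simp only [kerrMetric, sphereMetric, rad, cosTh, dr, sinSqDphi, h _ (by decide : (1 : Fin 4) ≠ 0),
      h _ (by decide : (2 : Fin 4) ≠ 0), h _ (by decide : (3 : Fin 4) ≠ 0)]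
  exact HasDerivAt.unique hl hc

/-! ### Energy and angular momentum -/

theorem dr_dotProduct (x u : Fin 4 → ℝ) :
    dr x ⬝ᵥ u = (x 1 * u 1 + x 2 * u 2 + x 3 * u 3) / rad x := by
  simp [dr, dotProduct, Fin.sum_univ_four]
  ring

theorem sinSqDphi_dotProduct (x u : Fin 4 → ℝ) :
    sinSqDphi x ⬝ᵥ u = (x 1 * u 2 - x 2 * u 1) / rad x ^ 2 := by
  simp [sinSqDphi, dotProduct, Fin.sum_univ_four]
  ring

theorem dt_dotProduct (u : Fin 4 → ℝ) : dt ⬝ᵥ u = u 0 := by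
  simp [dt, dotProduct, Fin.sum_univ_four]

/-- The angular momentum `g(∂_φ, u)`; here `(x₁² + x₂²) / r² = sin² θ`. -/
theorem axial_dotProduct_mulVec (m a : ℝ) (x u : Fin 4 → ℝ) :
    axial x ⬝ᵥ kerrMetric m a x *ᵥ u =
      (lam a (rad x) (cosTh x) + a ^ 2 * (1 + 2 * m * rad x / lam a (rad x) (cosTh x))
        * ((x 1 ^ 2 + x 2 ^ 2) / rad x ^ 2)) * (sinSqDphi x ⬝ᵥ u)
      - 2 * m * rad x * a / lam a (rad x) (cosTh x) * ((x 1 ^ 2 + x 2 ^ 2) / rad x ^ 2) * u 0 := by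
  have h1 : dr x ⬝ᵥ axial x = 0 := by
    rw [dr_dotProduct]; simp [axial]; left; ring
  have h2 : sinSqDphi x ⬝ᵥ axial x = (x 1 ^ 2 + x 2 ^ 2) / rad x ^ 2 := by
    rw [sinSqDphi_dotProduct]; simp [axial]; ring
  have h3 : (axial x ⬝ᵥ u) / rad x ^ 2 = sinSqDphi x ⬝ᵥ u := by
    rw [sinSqDphi_dotProduct]; simp [axial, dotProduct, Fin.sum_univ_four]; ring
  have h4 : axial x 0 = 0 := rfl
  rw [kerrMetric_apply, h1, h2, dt_dotProduct, dt_dotProduct, h4, ← h3]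
  ring

/-- The energy `g(∂_t, u)`, up to sign: the components of `∂_t` are those of `dt`. -/
theorem dt_dotProduct_mulVec (m a : ℝ) (x u : Fin 4 → ℝ) :
    dt ⬝ᵥ kerrMetric m a x *ᵥ u =
      -beta m a (rad x) (cosTh x) * u 0
        - 2 * m * rad x * a / lam a (rad x) (cosTh x) * (sinSqDphi x ⬝ᵥ u) := by
  have h1 : dr x ⬝ᵥ dt = 0 := by rw [dr_dotProduct]; simp [dt]
  have h2 : sinSqDphi x ⬝ᵥ dt = 0 := by rw [sinSqDphi_dotProduct]; simp [dt]
  have h4 : dt 0 = 1 := rfl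
  rw [kerrMetric_apply, h1, h2, dt_dotProduct, dt_dotProduct, h4]
  ring

/-- For zero angular momentum the energy is a nonzero multiple of `t'`, and `t' = 0` forces
`sin² θ φ' = 0`. -/
theorem exists_energy_eq_neg_mul {m a : ℝ} (hm : 0 < m) {x u : Fin 4 → ℝ} (hx : 0 < rad x)
    (hβ : 0 < beta m a (rad x) (cosTh x)) (hL : axial x ⬝ᵥ kerrMetric m a x *ᵥ u = 0) :
    (∃ q > 0, dt ⬝ᵥ kerrMetric m a x *ᵥ u = -q * u 0) ∧
      (u 0 = 0 → sinSqDphi x ⬝ᵥ u = 0) := by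
  rw [axial_dotProduct_mulVec] at hL
  rw [dt_dotProduct_mulVec]
  have hl := lam_pos hx a (cosTh x)
  set S := (x 1 ^ 2 + x 2 ^ 2) / rad x ^ 2
  set K := lam a (rad x) (cosTh x) + a ^ 2 * (1 + 2 * m * rad x / lam a (rad x) (cosTh x)) * S
  have hS : 0 ≤ S := by positivity
  have hK : 0 < K := by positivity
  set D := 2 * m * rad x * a / lam a (rad x) (cosTh x)
  -- Vanishing angular momentum determines `sin² θ φ'` in terms of `t'`.
  have hw : sinSqDphi x ⬝ᵥ u = D * S * u 0 / K := by
    rw [eq_div_iff hK.ne']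
    linarith
  refine ⟨⟨beta m a (rad x) (cosTh x) + D ^ 2 * S / K, by positivity, ?_⟩, fun h => ?_⟩
  · rw [hw]
    ring
  · rw [hw, h]
    simp

/-! ### Radial motion in a meridian plane -/

theorem rad_add_smul_spatial (x : Fin 4 → ℝ) {e : ℝ} (he : -1 < e) :
    rad (x + e • spatial x) = (1 + e) * rad x := by
  rw [rad, rad, ← Real.sqrt_sq (by linarith : 0 ≤ 1 + e), ← Real.sqrt_mul (by positivity)]
  congr 1
  simp [spatial]
  ring

/-- The squared length of the part of `u` tangent to the spheres of constant `t` and `r`, for the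
Euclidean metric of `ℝ³`. -/
def angularSq (x u : Fin 4 → ℝ) : ℝ := u ⬝ᵥ u - u 0 ^ 2 - (dr x ⬝ᵥ u) ^ 2

theorem angularSq_nonneg {x : Fin 4 → ℝ} (hx : 0 < rad x) (u : Fin 4 → ℝ) :
    0 ≤ angularSq x u := by
  have h := sq_rad x
  have h2 : 0 < rad x ^ 2 := by positivity
  rw [angularSq, dr_dotProduct, div_pow, sub_nonneg, div_le_iff₀ h2, h]
  simp only [dotProduct, Fin.sum_univ_four]
  nlinarith [sq_nonneg (x 1 * u 2 - x 2 * u 1), sq_nonneg (x 1 * u 3 - x 3 * u 1),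
    sq_nonneg (x 2 * u 3 - x 3 * u 2)]

theorem kerrMetric_quadratic_of_meridian {m a : ℝ} {x u : Fin 4 → ℝ} (ht : u 0 = 0)
    (hw : sinSqDphi x ⬝ᵥ u = 0) :
    u ⬝ᵥ kerrMetric m a x *ᵥ u =
      lam a (rad x) (cosTh x) / Del m a (rad x) * (dr x ⬝ᵥ u) ^ 2
        + lam a (rad x) (cosTh x) / rad x ^ 2 * angularSq x u := by
  rw [kerrMetric_apply, dt_dotProduct, hw, ht, angularSq, ht]
  ring

/-- The derivative of the metric along the dilation field, evaluated on a vector `u` tangent to a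
meridian plane in a slice of constant `t`. The field `r ∂_r` is not Killing, but dilations keep
`cos θ` and the components of `dr` fixed, so that only the dependence on `r` of `λ / Δ` and `λ / r²` is
differentiated. -/
theorem fderiv_kerrMetric_spatial {m a : ℝ} {x u : Fin 4 → ℝ} (hx : 0 < rad x)
    (hD : Del m a (rad x) ≠ 0) (ht : u 0 = 0) (hw : sinSqDphi x ⬝ᵥ u = 0) :
    fderiv ℝ (fun y => u ⬝ᵥ kerrMetric m a y *ᵥ u) x (spatial x) =
      rad x * (2 * rad x * Del m a (rad x) - lam a (rad x) (cosTh x) * (2 * rad x - 2 * m))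
        / Del m a (rad x) ^ 2 * (dr x ⬝ᵥ u) ^ 2
      - 2 * a ^ 2 * cosTh x ^ 2 / rad x ^ 2 * angularSq x u := by
  have hl := (differentiableAt_kerrMetric_quadratic hx hD u).hasFDerivAt.hasLineDerivAt
    (spatial x)
  have hev : (fun e : ℝ => u ⬝ᵥ kerrMetric m a (x + e • spatial x) *ᵥ u) =ᶠ[nhds 0] fun e =>
      lam a ((1 + e) * rad x) (cosTh x) / Del m a ((1 + e) * rad x) * (dr x ⬝ᵥ u) ^ 2
        + lam a ((1 + e) * rad x) (cosTh x) / ((1 + e) * rad x) ^ 2 * angularSq x u := by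
    filter_upwards [lt_mem_nhds (by norm_num : (-1 : ℝ) < 0)] with e he
    have hr := rad_add_smul_spatial x he
    have he' : 1 + e ≠ 0 := by linarith
    have hdr : dr (x + e • spatial x) ⬝ᵥ u = dr x ⬝ᵥ u := by
      rw [dr_dotProduct, dr_dotProduct, hr]
      simp only [Pi.add_apply, Pi.smul_apply, smul_eq_mul, spatial, cons_val]
      field_simp
    have hc : cosTh (x + e • spatial x) = cosTh x := by
      rw [cosTh, cosTh, hr]
      simp only [Pi.add_apply, Pi.smul_apply, smul_eq_mul, spatial, cons_val]
      field_simp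
    have hs : sinSqDphi (x + e • spatial x) ⬝ᵥ u = 0 := by
      have h := sinSqDphi_dotProduct x u
      rw [hw, eq_comm, div_eq_zero_iff, or_iff_left (by positivity)] at h
      rw [sinSqDphi_dotProduct]
      simp only [Pi.add_apply, Pi.smul_apply, smul_eq_mul, spatial, cons_val]
      rw [div_eq_zero_iff]
      left
      linear_combination (1 + e) * h
    rw [kerrMetric_quadratic_of_meridian ht hs, hr, hdr, hc, angularSq, angularSq, hdr]
  have hρ : HasDerivAt (fun e : ℝ => (1 + e) * rad x) (rad x) 0 :=
    (((hasDerivAt_id (0 : ℝ)).const_add 1).mul_const (rad x)).congr_deriv (by simp)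
  have hlam : HasDerivAt (fun e : ℝ => lam a ((1 + e) * rad x) (cosTh x)) (2 * rad x ^ 2) 0 := by
    unfold lam
    exact ((hρ.pow 2).add_const _).congr_deriv (by simp; ring)
  have hΔ : HasDerivAt (fun e : ℝ => Del m a ((1 + e) * rad x))
      (rad x * (2 * rad x - 2 * m)) 0 := by
    unfold Del
    exact (((hρ.pow 2).sub (hρ.const_mul (2 * m))).add_const _).congr_deriv (by simp; ring)
  have hexp := ((hlam.div hΔ (by simpa using hD)).mul_const ((dr x ⬝ᵥ u) ^ 2)).add
    ((hlam.div (hρ.pow 2) (by simpa using hx.ne')).mul_const (angularSq x u))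
  have h := (HasDerivAt.congr_of_eventuallyEq hl hev.symm).unique hexp
  rw [h]
  have hr0 := hx.ne'
  simp only [add_zero, one_mul, Pi.pow_apply]
  congr 1
  · field_simp
  · rw [lam]
    field_simp
    ring

/-- The component of the momentum along the dilation field is `λ r r' / Δ`. -/
theorem spatial_dotProduct_mulVec {m a : ℝ} {x : Fin 4 → ℝ} (hx : 0 < rad x) (u : Fin 4 → ℝ) :
    spatial x ⬝ᵥ kerrMetric m a x *ᵥ u =
      lam a (rad x) (cosTh x) / Del m a (rad x) * (rad x * (dr x ⬝ᵥ u)) := by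
  have h1 : dr x ⬝ᵥ spatial x = rad x := by
    rw [dr_dotProduct, div_eq_iff hx.ne', ← sq, sq_rad]
    simp [spatial]
    ring
  have h2 : sinSqDphi x ⬝ᵥ spatial x = 0 := by
    rw [sinSqDphi_dotProduct]; simp [spatial]; left; ring
  have h3 : spatial x ⬝ᵥ u = rad x * (dr x ⬝ᵥ u) := by
    rw [dr_dotProduct]
    field_simp
    simp [spatial, dotProduct, Fin.sum_univ_four]
  have h4 : spatial x 0 = 0 := rfl
  rw [kerrMetric_apply, h1, h2, h3, dt_dotProduct, dt_dotProduct, h4]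
  ring

theorem hasDerivWithinAt_rad {γ : ℝ → Fin 4 → ℝ} {u : Fin 4 → ℝ} {I : Set ℝ} {s : ℝ}
    (hx : 0 < rad (γ s)) (hγ : HasDerivWithinAt γ u I s) :
    HasDerivWithinAt (fun s => rad (γ s)) (dr (γ s) ⬝ᵥ u) I s := by
  have h := hasDerivWithinAt_pi.1 hγ
  have h0 : γ s 1 ^ 2 + γ s 2 ^ 2 + γ s 3 ^ 2 ≠ 0 := (Real.sqrt_pos.1 hx).ne'
  unfold rad
  refine (((((h 1).pow 2).add ((h 2).pow 2)).add ((h 3).pow 2)).sqrt h0).congr_deriv ?_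
  rw [dr_dotProduct]
  simp only [Pi.add_apply, Pi.pow_apply]
  change _ / (2 * rad (γ s)) = _
  field_simp
  simp
  ring

theorem hasDerivWithinAt_spatial {γ : ℝ → Fin 4 → ℝ} {u : Fin 4 → ℝ} {I : Set ℝ} {s : ℝ}
    (hγ : HasDerivWithinAt γ u I s) :
    HasDerivWithinAt (fun s => spatial (γ s)) (spatial u) I s := by
  have h := hasDerivWithinAt_pi.1 hγ
  rw [hasDerivWithinAt_pi]
  intro i
  fin_cases i
  exacts [hasDerivWithinAt_const _ _ _, h 1, h 2, h 3]

theorem hasDerivWithinAt_axial {γ : ℝ → Fin 4 → ℝ} {u : Fin 4 → ℝ} {I : Set ℝ} {s : ℝ}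
    (hγ : HasDerivWithinAt γ u I s) :
    HasDerivWithinAt (fun s => axial (γ s)) (axial u) I s := by
  have h := hasDerivWithinAt_pi.1 hγ
  rw [hasDerivWithinAt_pi]
  intro i
  fin_cases i
  exacts [hasDerivWithinAt_const _ _ _, (h 2).neg, h 1, hasDerivWithinAt_const _ _ _]

theorem Del_pos_of_rPlus_lt {m a r : ℝ} (ham : a ^ 2 ≤ m ^ 2) (hr : rPlus m a < r) :
    0 < Del m a r := by
  have h := Real.sq_sqrt (sub_nonneg.2 ham)
  have h0 := Real.sqrt_nonneg (m ^ 2 - a ^ 2)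
  unfold rPlus at hr
  unfold Del
  nlinarith

/-- Where a geodesic is tangent to a meridian plane in a slice of constant `t`, the quantity
`λ r'` has nonnegative derivative. The derivative is obtained from `λ r' = (Δ / r) g(r ∂_r, γ')`. -/
theorem exists_hasDerivWithinAt_lam_mul_dr {m a : ℝ} {γ v : ℝ → Fin 4 → ℝ} {I : Set ℝ} {s : ℝ}
    (hs : s ∈ I) (hpos : ∀ s ∈ I, 0 < rad (γ s) ∧ 0 < Del m a (rad (γ s)))
    (hmr : m ≤ rad (γ s)) (ht : v s 0 = 0) (hw : sinSqDphi (γ s) ⬝ᵥ v s = 0)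
    (hγ : HasDerivWithinAt γ (v s) I s)
    (hv : HasDerivWithinAt v (fun k => -∑ i, ∑ j,
      SemiRiem.christoffel (kerrMetric m a) k i j (γ s) * v s i * v s j) I s) :
    ∃ f', 0 ≤ f' ∧ HasDerivWithinAt
      (fun s => lam a (rad (γ s)) (cosTh (γ s)) * (dr (γ s) ⬝ᵥ v s)) f' I s := by
  obtain ⟨hx, hD⟩ := hpos s hs
  have hdet : (kerrMetric m a (γ s)).det ≠ 0 := by
    rw [det_kerrMetric m a _ hx hD.ne']
    have := lam_pos hx a (cosTh (γ s))
    exact neg_ne_zero.2 (by positivity)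
  have hP := SemiRiem.hasDerivWithinAt_momentum (isSymm_kerrMetric m a) hdet
    (differentiableAt_kerrMetric hx hD.ne') hγ hv (hasDerivWithinAt_spatial hγ)
  have hsp : spatial (v s) = v s := by
    ext i
    fin_cases i
    exacts [ht.symm, rfl, rfl, rfl]
  rw [hsp, fderiv_kerrMetric_spatial hx hD.ne' ht hw,
    kerrMetric_quadratic_of_meridian ht hw] at hP
  have hρ := hasDerivWithinAt_rad hx hγ
  have hΔ : HasDerivWithinAt (fun s => Del m a (rad (γ s)))
      ((2 * rad (γ s) - 2 * m) * (dr (γ s) ⬝ᵥ v s)) I s := by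
    unfold Del
    exact (((hρ.pow 2).sub (hρ.const_mul (2 * m))).add_const _).congr_deriv (by simp; ring)
  have hf := (hΔ.div hρ hx.ne').mul hP
  have hcongr : ∀ s ∈ I, lam a (rad (γ s)) (cosTh (γ s)) * (dr (γ s) ⬝ᵥ v s) =
      Del m a (rad (γ s)) / rad (γ s) * (spatial (γ s) ⬝ᵥ kerrMetric m a (γ s) *ᵥ v s) := by
    intro s hs
    obtain ⟨hx, hD⟩ := hpos s hs
    rw [spatial_dotProduct_mulVec hx]
    field_simp
  refine ⟨_, ?_, hf.congr_of_mem hcongr hs⟩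
  have hh := angularSq_nonneg hx (v s)
  simp only [Pi.div_apply]
  rw [spatial_dotProduct_mulVec hx]
  have hl := lam_pos hx a (cosTh (γ s))
  have hlam : lam a (rad (γ s)) (cosTh (γ s)) = rad (γ s) ^ 2 + a ^ 2 * cosTh (γ s) ^ 2 := rfl
  generalize lam a (rad (γ s)) (cosTh (γ s)) = L at *
  generalize Del m a (rad (γ s)) = D at *
  generalize rad (γ s) = r at *
  generalize angularSq (γ s) (v s) = h at *
  generalize dr (γ s) ⬝ᵥ v s = p at *
  generalize cosTh (γ s) = c at *
  -- The derivative of `λ r'`; `h / r²` is `θ'²` in the meridian plane.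
  have key : 0 ≤ L * (r - m) / D * p ^ 2 + D / r * h + r * p ^ 2 := by
    have := sub_nonneg.2 hmr
    positivity
  refine key.trans_eq ?_
  have hac : a ^ 2 * c ^ 2 = L - r ^ 2 := by linarith
  rw [mul_assoc 2 (a ^ 2), hac]
  field_simp
  ring

/-! ### No interior maximum of the radius -/

theorem eq_of_hasDerivWithinAt_Icc_zero {f : ℝ → ℝ}
    (hf : ∀ s ∈ Icc (0 : ℝ) 1, HasDerivWithinAt f 0 (Icc 0 1) s) {s t : ℝ}
    (hs : s ∈ Icc (0 : ℝ) 1) (ht : t ∈ Icc (0 : ℝ) 1) : f s = f t := by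
  have h := Convex.norm_image_sub_le_of_norm_hasDerivWithin_le (C := 0) hf (by simp)
    (convex_Icc 0 1) ht hs
  simpa [sub_eq_zero] using h

/-- A function has no interior maximum above its boundary values if its derivative, multiplied by
a positive weight, is monotone: the derivative cannot change sign from positive to negative. -/
theorem le_max_of_monotoneOn_mul_deriv {ρ ρ' L : ℝ → ℝ}
    (hρ : ∀ s ∈ Icc (0 : ℝ) 1, HasDerivWithinAt ρ (ρ' s) (Icc 0 1) s)
    (hL : ∀ s ∈ Icc (0 : ℝ) 1, 0 < L s)
    (hmono : MonotoneOn (fun s => L s * ρ' s) (Icc 0 1)) {s : ℝ} (hs : s ∈ Icc (0 : ℝ) 1) :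
    ρ s ≤ max (ρ 0) (ρ 1) := by
  by_contra! h
  obtain ⟨h0, h1⟩ := max_lt_iff.1 h
  have hs0 : 0 < s := hs.1.lt_of_ne (by rintro rfl; exact lt_irrefl _ h0)
  have hs1 : s < 1 := hs.2.lt_of_ne (by rintro rfl; exact lt_irrefl _ h1)
  have hc : ContinuousOn ρ (Icc 0 1) := fun s hs => (hρ s hs).continuousWithinAt
  have hd : ∀ t ∈ Ioo (0 : ℝ) 1, HasDerivAt ρ (ρ' t) t := fun t ht =>
    (hρ t (Ioo_subset_Icc_self ht)).hasDerivAt (Icc_mem_nhds ht.1 ht.2)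
  obtain ⟨p, hp, hp'⟩ := exists_hasDerivAt_eq_slope ρ ρ' hs0
    (hc.mono (Icc_subset_Icc_right hs.2)) fun t ht => hd t ⟨ht.1, ht.2.trans hs1⟩
  obtain ⟨q, hq, hq'⟩ := exists_hasDerivAt_eq_slope ρ ρ' hs1
    (hc.mono (Icc_subset_Icc_left hs.1)) fun t ht => hd t ⟨hs0.trans ht.1, ht.2⟩
  have hpI : p ∈ Icc (0 : ℝ) 1 := ⟨hp.1.le, (hp.2.trans hs1).le⟩
  have hqI : q ∈ Icc (0 : ℝ) 1 := ⟨(hs0.trans hq.1).le, hq.2.le⟩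
  have hp0 : 0 < ρ' p := hp' ▸ div_pos (by linarith) (by linarith)
  have hq0 : ρ' q < 0 := hq' ▸ div_neg_of_neg_of_pos (by linarith) (by linarith)
  have h1 := hmono hpI hqI (hp.2.trans hq.1).le
  have h2 := mul_pos (hL p hpI) hp0
  have h3 := mul_neg_of_pos_of_neg (hL q hqI) hq0
  exact absurd h1 (h3.trans h2).not_ge

/-- On a geodesic of the stationary region that starts on the axis and ends at the time at which it
starts, `r` is at most its larger boundary value. -/
theorem rad_le_max_of_isGeodesicOn {m a : ℝ} (hm : 0 < m) (ham : a ^ 2 ≤ m ^ 2)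
    {γ : ℝ → Fin 4 → ℝ} (hM : ∀ s ∈ Icc (0 : ℝ) 1, γ s ∈ stationaryKerr m a)
    (hγ : SemiRiem.IsGeodesicOn (kerrMetric m a) γ (Icc 0 1)) (haxis : axial (γ 0) = 0)
    (htime : γ 0 0 = γ 1 0) {s : ℝ} (hs : s ∈ Icc (0 : ℝ) 1) :
    rad (γ s) ≤ max (rad (γ 0)) (rad (γ 1)) := by
  obtain ⟨v, hγ, hv⟩ := hγ
  have h01 : (0 : ℝ) ∈ Icc (0 : ℝ) 1 := ⟨le_rfl, zero_le_one⟩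
  have hM' := fun s hs => (mem_stationaryKerr_iff m a hm (γ s)).1 (hM s hs)
  have hmr : ∀ s ∈ Icc (0 : ℝ) 1, m < rad (γ s) := fun s hs =>
    (le_add_of_nonneg_right (Real.sqrt_nonneg _)).trans_lt (hM' s hs).1
  have hr : ∀ s ∈ Icc (0 : ℝ) 1, 0 < rad (γ s) := fun s hs => hm.trans (hmr s hs)
  have hD : ∀ s ∈ Icc (0 : ℝ) 1, 0 < Del m a (rad (γ s)) := fun s hs =>
    Del_pos_of_rPlus_lt ham (hM' s hs).1
  have hmom := fun (Y : ℝ → Fin 4 → ℝ) (Y' : Fin 4 → ℝ) s (hs : s ∈ Icc (0 : ℝ) 1)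
      (hY : HasDerivWithinAt Y Y' (Icc 0 1) s) =>
    SemiRiem.hasDerivWithinAt_momentum (isSymm_kerrMetric m a)
      (by
        rw [det_kerrMetric m a _ (hr s hs) (hD s hs).ne']
        have := lam_pos (hr s hs) a (cosTh (γ s))
        have := hr s hs
        exact neg_ne_zero.2 (by positivity))
      (differentiableAt_kerrMetric (hr s hs) (hD s hs).ne') (hγ s hs) (hv s hs) hY
  have hE : ∀ s ∈ Icc (0 : ℝ) 1, ∀ t ∈ Icc (0 : ℝ) 1,
      dt ⬝ᵥ kerrMetric m a (γ s) *ᵥ v s = dt ⬝ᵥ kerrMetric m a (γ t) *ᵥ v t := by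
    intro s hs t ht
    refine eq_of_hasDerivWithinAt_Icc_zero
      (f := fun s => dt ⬝ᵥ kerrMetric m a (γ s) *ᵥ v s) (fun s hs => ?_) hs ht
    refine (hmom (fun _ => dt) 0 s hs (hasDerivWithinAt_const _ _ _)).congr_deriv ?_
    rw [fderiv_kerrMetric_time (hr s hs) (hD s hs).ne']
    simp
  have hL : ∀ s ∈ Icc (0 : ℝ) 1, axial (γ s) ⬝ᵥ kerrMetric m a (γ s) *ᵥ v s = 0 := by
    intro s hs
    rw [eq_of_hasDerivWithinAt_Icc_zero
      (f := fun s => axial (γ s) ⬝ᵥ kerrMetric m a (γ s) *ᵥ v s) (fun s hs => ?_) hs h01]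
    · simp only [haxis, zero_dotProduct]
    refine (hmom _ _ s hs (hasDerivWithinAt_axial (hγ s hs))).congr_deriv ?_
    rw [fderiv_kerrMetric_axial (hr s hs) (hD s hs).ne']
    ring
  have hkey := fun s hs => exists_energy_eq_neg_mul hm (hr s hs) (hM' s hs).2 (hL s hs)
  have hγ0 : ∀ s ∈ Icc (0 : ℝ) 1, HasDerivWithinAt (fun s => γ s 0) (v s 0) (Icc 0 1) s :=
    fun s hs => hasDerivWithinAt_pi.1 (hγ s hs) 0
  have ht : ∀ s ∈ Icc (0 : ℝ) 1, v s 0 = 0 := by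
    -- By Rolle's theorem `t'` vanishes at some `c`, so the conserved energy is zero.
    obtain ⟨c, hc, hc0⟩ := exists_hasDerivAt_eq_zero (f := fun s => γ s 0)
      (f' := fun s => v s 0) zero_lt_one (fun s hs => (hγ0 s hs).continuousWithinAt) htime
      fun s hs => (hγ0 s (Ioo_subset_Icc_self hs)).hasDerivAt (Icc_mem_nhds hs.1 hs.2)
    have hcI := Ioo_subset_Icc_self hc
    intro s hs
    obtain ⟨⟨q, hq, hqs⟩, -⟩ := hkey s hs
    obtain ⟨⟨q', -, hqc⟩, -⟩ := hkey c hcI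
    rw [hE s hs c hcI, hqc, hc0, mul_zero, eq_comm, neg_mul, neg_eq_zero, mul_eq_zero] at hqs
    exact hqs.resolve_left hq.ne'
  have hf := fun s (hs : s ∈ Icc (0 : ℝ) 1) => exists_hasDerivWithinAt_lam_mul_dr hs
    (fun s hs => ⟨hr s hs, hD s hs⟩) (hmr s hs).le (ht s hs) ((hkey s hs).2 (ht s hs))
    (hγ s hs) (hv s hs)
  choose! f' hf0 hf' using hf
  refine le_max_of_monotoneOn_mul_deriv (ρ := fun s => rad (γ s))
    (fun s hs => hasDerivWithinAt_rad (hr s hs) (hγ s hs))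
    (fun s hs => lam_pos (hr s hs) a (cosTh (γ s))) ?_ hs
  exact monotoneOn_of_hasDerivWithinAt_nonneg (convex_Icc 0 1)
    (fun s hs => (hf' s hs).continuousWithinAt)
    (fun s hs => (hf' s (interior_subset hs)).mono interior_subset)
    fun s hs => hf0 s (interior_subset hs)

theorem ofBL_mem_stationaryKerr_of_cos_sq_eq_one {m a : ℝ} (hm : 0 < m) {b : Fin 4 → ℝ}
    (hb : rPlus m a < b 1) (hc : Real.cos (b 2) ^ 2 = 1) : ofBL b ∈ stationaryKerr m a := by
  have h0 : 0 < b 1 := by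
    have := Real.sqrt_nonneg (m ^ 2 - a ^ 2)
    unfold rPlus at hb
    linarith
  change m + √(m ^ 2 - a ^ 2 * cosTh (ofBL b) ^ 2) < rad (ofBL b)
  rw [rad_ofBL b h0.le, cosTh_ofBL b h0, hc, mul_one]
  exact hb

/-! ### Crossing the equatorial plane -/

theorem not_joinedByGeodesic_of_axis {m a : ℝ} (hm : 0 < m) (ham : a ^ 2 ≤ m ^ 2) {r₀ r₁ : ℝ}
    (h0 : 0 ≤ r₀) (h1 : 0 ≤ r₁) (hr₀ : r₀ ≤ 2 * m) (hr₁ : r₁ ≤ 2 * m) :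
    ¬ SemiRiem.JoinedByGeodesic (kerrMetric m a) (stationaryKerr m a)
      (ofBL ![0, r₀, 0, 0]) (ofBL ![0, r₁, Real.pi, 0]) := by
  rintro ⟨γ, hγ0, hγ1, hM, hγ⟩
  have hcont : ContinuousOn (fun s => γ s 3) (Icc 0 1) := by
    obtain ⟨v, hv, -⟩ := hγ
    exact fun s hs => (hasDerivWithinAt_pi.1 (hv s hs) 3).continuousWithinAt
  obtain ⟨s, hs, hs3⟩ : (0 : ℝ) ∈ (fun s => γ s 3) '' Icc 0 1 := by
    refine intermediate_value_Icc' zero_le_one hcont ⟨?_, ?_⟩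
    · simp [hγ1, ofBL, h1]
    · simp [hγ0, ofBL, h0]
  have hmax := rad_le_max_of_isGeodesicOn hm ham hM hγ
    (by
      rw [hγ0]
      ext i
      fin_cases i <;> simp [axial, ofBL])
    (by simp [hγ0, hγ1, ofBL]) hs
  rw [hγ0, hγ1, rad_ofBL _ (by simpa using h0), rad_ofBL _ (by simpa using h1)] at hmax
  have h2 : rad (γ s) ≤ 2 * m := hmax.trans (max_le hr₀ hr₁)
  have h3 : m + √(m ^ 2 - a ^ 2 * cosTh (γ s) ^ 2) < rad (γ s) := hM s hs
  -- On the equatorial plane the stationary region is `r > 2 m`.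
  have hc : cosTh (γ s) = 0 := by
    rw [cosTh, show γ s 3 = 0 from hs3, zero_div]
  rw [hc, zero_pow two_ne_zero, mul_zero, sub_zero, Real.sqrt_sq hm.le] at h3
  linarith

end Kerr

end

theorem theorem4p1 (m a : ℝ) (hm : 0 < m) (ha : 0 < a ^ 2) (ham : a ^ 2 ≤ m ^ 2) :
    (¬ SemiRiem.GeodesicallyConnected (Kerr.kerrMetric m a) (Kerr.stationaryKerr m a)) ∧
    (∀ r₀ r₁ : ℝ, Kerr.rPlus m a < r₀ → r₀ < r₁ → r₁ < 2 * m →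
      Kerr.ofBL ![0, r₀, 0, 0] ∈ Kerr.stationaryKerr m a ∧
      Kerr.ofBL ![0, r₁, Real.pi, 0] ∈ Kerr.stationaryKerr m a ∧
      ¬ SemiRiem.JoinedByGeodesic (Kerr.kerrMetric m a) (Kerr.stationaryKerr m a)
          (Kerr.ofBL ![0, r₀, 0, 0]) (Kerr.ofBL ![0, r₁, Real.pi, 0])) := by
  have hpos : 0 < Kerr.rPlus m a := add_pos_of_pos_of_nonneg hm (Real.sqrt_nonneg _)
  have main : ∀ r₀ r₁ : ℝ, Kerr.rPlus m a < r₀ → r₀ < r₁ → r₁ < 2 * m →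
      Kerr.ofBL ![0, r₀, 0, 0] ∈ Kerr.stationaryKerr m a ∧
      Kerr.ofBL ![0, r₁, Real.pi, 0] ∈ Kerr.stationaryKerr m a ∧
      ¬ SemiRiem.JoinedByGeodesic (Kerr.kerrMetric m a) (Kerr.stationaryKerr m a)
          (Kerr.ofBL ![0, r₀, 0, 0]) (Kerr.ofBL ![0, r₁, Real.pi, 0]) := by
    intro r₀ r₁ h0 h01 h1
    exact ⟨Kerr.ofBL_mem_stationaryKerr_of_cos_sq_eq_one hm h0 (by simp),
      Kerr.ofBL_mem_stationaryKerr_of_cos_sq_eq_one hm (h0.trans h01) (by simp),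
      Kerr.not_joinedByGeodesic_of_axis hm ham (hpos.trans h0).le
        (hpos.trans (h0.trans h01)).le (h01.trans h1).le h1.le⟩
  refine ⟨fun hconn => ?_, main⟩
  have hlt : Kerr.rPlus m a < 2 * m := by
    have : √(m ^ 2 - a ^ 2) < m := (Real.sqrt_lt' hm).2 (by linarith)
    unfold Kerr.rPlus
    linarith
  obtain ⟨r₀, h0, h0'⟩ := exists_between hlt
  obtain ⟨r₁, h1, h1'⟩ := exists_between h0'
  obtain ⟨hp, hq, hpq⟩ := main r₀ r₁ h0 h1 h1'
  exact hpq (hconn _ hp _ hq)
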